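/- Let $\Gamma$ be a finite simple connected graph with vertex set $V(\Gamma)$ and edge set $E(\Gamma)$, and let $$G(\Gamma)=\langle\, v\in V(\Gamma)\mid [v,w]=1 \text{ if } \{v,w\}\notin E(\Gamma)\,\rangle .$$ For $g\in G(\Gamma)$ let $|g|$ be the length of a shortest word in $V(\Gamma)\cup V(\Gamma)^{-1}$ representing $g$ (such a shortest word is called reduced), and let $\operatorname{supp}(g)$ be the set of all $v\in V(\Gamma)$ such that $v$ or $v^{-1}$ appears in a reduced word representing $g$. Two elements $g_1,g_2$ disjointly commute if $\operatorname{supp}(g_1)\cap\operatorname{supp}(g_2)=\emptyset$ and $\{v_1,v_2\}\notin E(\Gamma)$ for all $v_1\in\operatorname{supp}(g_1)$, $v_2\in\operatorname{supp}(g_2)$. An element $g$ is strongly non-split if $\operatorname{supp}(g)$ spans a connected subgraph of $\Gamma$ and no generator $v\in V(\Gamma)$ disjointly commutes with $g$. An element $g\neq 1$ is primitive if $g\ne u^n$ for all $u\in G(\Gamma)$ and $n\ge 2$. An element $g$ is a $(\lambda,N)$-quasi-root of $h\in G(\Gamma)$ if there are an integer $n\ge N$ and $a,b\in G(\Gamma)$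 with $$h=ag^nb,\qquad |h|=|a|+n|g|+|b|,\qquad |a|\le\lambda|h|,\qquad |b|\le\lambda|h| .$$ For every real $\lambda\in[0,\tfrac12)$ there is an integer $N\ge 3$ such that strongly non-split, primitive $(\lambda,N)$-quasi-roots in $G(\Gamma)$ are unique up to conjugacy: for every $h\in G(\Gamma)$, if $g_1$ and $g_2$ are strongly non-split, primitive $(\lambda,N)$-quasi-roots of $h$, then $g_1$ and $g_2$ are conjugate in $G(\Gamma)$. -/

import Mathlib

namespace RAAG

variable {V : Type*}

/-- The commutators `[v, w]` of all pairs of vertices that are *not* joined by an edge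
(for `v = w` this commutator is trivial). -/
def rels (Γ : SimpleGraph V) : Set (FreeGroup V) :=
  {r | ∃ v w : V, ¬ Γ.Adj v w ∧
    r = FreeGroup.of v * FreeGroup.of w * (FreeGroup.of v)⁻¹ * (FreeGroup.of w)⁻¹}

/-- `G(Γ) = ⟨ v ∈ V(Γ) | [v, w] = 1 if {v, w} ∉ E(Γ) ⟩`, the right-angled Artin group on the
complement graph of `Γ`. -/
abbrev G (Γ : SimpleGraph V) : Type _ := PresentedGroup (rels Γ)

/-- The generator of `G(Γ)` given by a vertex. -/
def gen (Γ : SimpleGraph V) (v : V) : G Γ := PresentedGroup.of v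

/-- The element of `G(Γ)` represented by a word; the letter `(v, true)` is `v` and the letter
`(v, false)` is `v⁻¹`. -/
def eval (Γ : SimpleGraph V) (w : List (V × Bool)) : G Γ :=
  PresentedGroup.mk (rels Γ) (FreeGroup.mk w)

/-- Every element is represented by some word. -/
theorem eval_surjective (Γ : SimpleGraph V) : Function.Surjective (eval Γ) := by
  intro g
  obtain ⟨x, rfl⟩ := PresentedGroup.mk_surjective (rels Γ) g
  obtain ⟨w, rfl⟩ := Quot.exists_rep x
  exact ⟨w, rfl⟩

/-- A word is reduced if it is a shortest word among all words representing the same element. -/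
def IsReduced (Γ : SimpleGraph V) (w : List (V × Bool)) : Prop :=
  ∀ w' : List (V × Bool), eval Γ w' = eval Γ w → w.length ≤ w'.length

/-- The word length `|g|`: the minimal length of a word representing `g`. -/
noncomputable def wordLength {Γ : SimpleGraph V} (g : G Γ) : ℕ :=
  sInf {k : ℕ | ∃ w : List (V × Bool), eval Γ w = g ∧ w.length = k}

/-- The support of `g`: all `v` such that `v` or `v⁻¹` appears in a reduced word
representing `g`. -/
def supp {Γ : SimpleGraph V} (g : G Γ) : Set V :=
  {v | ∃ w : List (V × Bool), IsReduced Γ w ∧ eval Γ w = g ∧ ∃ ε : Bool, (v, ε) ∈ w}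

/-- `g₁` and `g₂` disjointly commute. -/
def DisjointlyCommute {Γ : SimpleGraph V} (g₁ g₂ : G Γ) : Prop :=
  Disjoint (supp g₁) (supp g₂) ∧ ∀ v₁ ∈ supp g₁, ∀ v₂ ∈ supp g₂, ¬ Γ.Adj v₁ v₂

/-- `g` is non-split if its support spans a connected subgraph of `Γ`. -/
def IsNonSplit {Γ : SimpleGraph V} (g : G Γ) : Prop :=
  (Γ.induce (supp g)).Connected

/-- `g` is strongly non-split if it is non-split and no generator disjointly commutes with it. -/
def IsStronglyNonSplit {Γ : SimpleGraph V} (g : G Γ) : Prop :=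
  IsNonSplit g ∧ ¬ ∃ v : V, DisjointlyCommute (gen Γ v) g

/-- `g` is primitive if it is nontrivial and not a proper power of another element. -/
def IsPrimitive {Γ : SimpleGraph V} (g : G Γ) : Prop :=
  g ≠ 1 ∧ ∀ (u : G Γ) (n : ℕ), 2 ≤ n → g ≠ u ^ n

/-- `g` is a `(lam, N)`-quasi-root of `h`: there is a geodesic decomposition
`h = a · g ⋯ g · b` with `n ≥ N` factors `g` and `|a|, |b| ≤ lam |h|`. -/
def IsQuasiRoot {Γ : SimpleGraph V} (lam : ℝ) (N : ℕ) (h g : G Γ) : Prop :=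
  ∃ (n : ℕ) (a b : G Γ), N ≤ n ∧ h = a * g ^ n * b ∧
    wordLength h = wordLength a + n * wordLength g + wordLength b ∧
    (wordLength a : ℝ) ≤ lam * wordLength h ∧ (wordLength b : ℝ) ≤ lam * wordLength h

end RAAG

/-! ### The trace monoid of a dependence relation -/

section Traces

/-! Geodesic words for a fixed `h` represent one and the same trace (a word up to swapping adjacent
independent letters), so two quasi-root decompositions of `h` become two factorisations `a₁ * g₁ ^ n
* b₁ = a₂ * g₂ ^ m * b₂` of a single trace. What remains is a Fine–Wilf argument for traces.

Left divisors of a trace are determined and ordered by their letter counts (`dvd_of_cnt_le`). They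
need not be comparable, but if `g` is strongly non-split, any two letters are linked by a chain of
at most `k = |V|` dependent letters of `g`. Each link costs one factor `g`, so a left divisor either
divides `a * g ^ (j + k)` or is divisible by `a * g ^ j` (`Spans.dvd_or_dvd`).

This aligns the two factorisations: after cancelling a common beginning and conjugating `g₂`, high
powers of `g₁` and of the conjugate begin the same trace. Then the two bases commute, hence are
powers of one trace `w`, and primitivity forces both to equal `w`. Since the ends cover at most the
fraction `2λ < 1` of `h`, a large `N` leaves enough overlap. -/

open Classical in
/-- The projection of a word to a two-letter alphabet. -/
noncomputable def wordProj {α : Type*} (x y : α) (w : List α) : List α :=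
  w.filter (fun z => decide (z = x ∨ z = y))

theorem wordProj_append {α : Type*} (x y : α) (u v : List α) :
    wordProj x y (u ++ v) = wordProj x y u ++ wordProj x y v := by
  simp [wordProj]

open Classical in
theorem wordProj_cons {α : Type*} (x y z : α) (v : List α) :
    wordProj x y (z :: v) = if z = x ∨ z = y then z :: wordProj x y v else wordProj x y v := by
  simp [wordProj, List.filter_cons]

theorem mem_wordProj {α : Type*} {x y z : α} {w : List α} :
    z ∈ wordProj x y w ↔ z ∈ w ∧ (z = x ∨ z = y) := by
  simp [wordProj]

/-- Two words are trace equivalent if all their projections to pairs of dependent letters agree. -/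
def traceSetoid {α : Type*} (D : α → α → Prop) : Setoid (List α) where
  r u v := ∀ x y, D x y → wordProj x y u = wordProj x y v
  iseqv := ⟨fun _ _ _ _ => rfl, fun h x y d => (h x y d).symm,
    fun h h' x y d => (h x y d).trans (h' x y d)⟩

/-- The trace monoid over the alphabet `α` with dependence relation `D`. -/
def Trace {α : Type*} (D : α → α → Prop) : Type _ := Quotient (traceSetoid D)

namespace Trace

variable {α : Type*} {D : α → α → Prop}

/-- The trace of a word. -/
def mk (D : α → α → Prop) (w : List α) : Trace D := Quotient.mk (traceSetoid D) w

theorem mk_eq_mk {u v : List α} :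
    mk D u = mk D v ↔ ∀ x y, D x y → wordProj x y u = wordProj x y v :=
  Quotient.eq

theorem mk_surjective (t : Trace D) : ∃ w, mk D w = t := Quotient.exists_rep t

instance : Mul (Trace D) where
  mul := Quotient.map₂ (· ++ ·) (by
    intro u u' hu v v' hv x y d
    simp only [wordProj_append, hu x y d, hv x y d])

instance : One (Trace D) where
  one := mk D []

theorem mk_append (u v : List α) : mk D (u ++ v) = mk D u * mk D v := rfl

theorem mk_nil : mk D [] = 1 := rfl

theorem mk_cons (x : α) (v : List α) : mk D (x :: v) = mk D [x] * mk D v := rfl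

instance : Monoid (Trace D) where
  mul_assoc a b c := by
    obtain ⟨u, rfl⟩ := mk_surjective a
    obtain ⟨v, rfl⟩ := mk_surjective b
    obtain ⟨w, rfl⟩ := mk_surjective c
    simp only [← mk_append, List.append_assoc]
  one_mul a := by
    obtain ⟨u, rfl⟩ := mk_surjective a
    rw [← mk_nil, ← mk_append, List.nil_append]
  mul_one a := by
    obtain ⟨u, rfl⟩ := mk_surjective a
    rw [← mk_nil, ← mk_append, List.append_nil]

instance : IsLeftCancelMul (Trace D) where
  mul_left_cancel a b c h := by
    obtain ⟨u, rfl⟩ := mk_surjective a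
    obtain ⟨v, rfl⟩ := mk_surjective b
    obtain ⟨w, rfl⟩ := mk_surjective c
    simp only [← mk_append, mk_eq_mk, wordProj_append, List.append_cancel_left_eq] at h
    exact mk_eq_mk.2 h

/-- The projection of a trace to a pair of dependent letters. -/
noncomputable def proj {x y : α} (d : D x y) : Trace D → List α :=
  Quotient.lift (wordProj x y) (fun _ _ h => h x y d)

theorem proj_mk {x y : α} (d : D x y) (w : List α) : proj d (mk D w) = wordProj x y w := rfl

theorem proj_mul {x y : α} (d : D x y) (s t : Trace D) :
    proj d (s * t) = proj d s ++ proj d t := by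
  obtain ⟨u, rfl⟩ := mk_surjective s
  obtain ⟨v, rfl⟩ := mk_surjective t
  rw [← mk_append, proj_mk, wordProj_append, proj_mk, proj_mk]

theorem mk_append_cons_of_indep (hD : ∀ x, D x x) (hs : ∀ x y, D x y → D y x) {x : α}
    {u : List α} (v : List α) (h : ∀ z ∈ u, ¬ D x z) :
    mk D (u ++ x :: v) = mk D (x :: (u ++ v)) := by
  refine mk_eq_mk.2 fun a b d => ?_
  simp only [wordProj_append, wordProj_cons]
  split_ifs with hx
  · have : wordProj a b u = [] := by
      refine List.eq_nil_iff_forall_not_mem.2 fun z hz => ?_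
      obtain ⟨hz, hab⟩ := mem_wordProj.1 hz
      apply h z hz
      rcases hx with rfl | rfl <;> rcases hab with rfl | rfl
      · exact hD _
      · exact d
      · exact hs _ _ d
      · exact hD _
    simp [this]
  · rfl

/-- The letters preceding the first occurrence of a possible first letter are independent
of it. -/
theorem indep_of_mk_cons_eq {x : α} {s u v : List α}
    (h : mk D (x :: s) = mk D (u ++ x :: v)) (hx : x ∉ u) : ∀ z ∈ u, ¬ D x z := by
  intro z hz d
  have h' := mk_eq_mk.1 h x z d
  rw [wordProj_append, wordProj_cons, if_pos (Or.inl rfl)] at h'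
  obtain ⟨y, l, hl⟩ := List.exists_cons_of_ne_nil
    (List.ne_nil_of_mem (mem_wordProj.2 ⟨hz, Or.inr rfl⟩ : z ∈ wordProj x z u))
  rw [hl, List.cons_append, List.cons.injEq] at h'
  have hy : y ∈ wordProj x z u := by rw [hl]; exact List.mem_cons_self
  exact hx (h'.1 ▸ (mem_wordProj.1 hy).1)

/-! ### Letter counts and left divisibility -/

open Classical in
/-- The number of occurrences of a letter in a trace. -/
noncomputable def cnt (hD : ∀ x, D x x) (x : α) (t : Trace D) : ℕ := (proj (hD x) t).length

section Count

variable (hD : ∀ x, D x x)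

open Classical in
theorem cnt_mk (x : α) (w : List α) : cnt hD x (mk D w) = w.count x := by
  rw [cnt, proj_mk, wordProj, List.count, List.countP_eq_length_filter]
  congr 2
  ext z
  simp only [or_self]
  exact Bool.eq_iff_iff.2 (by simp)

theorem cnt_mk_pos {x : α} {w : List α} : 0 < cnt hD x (mk D w) ↔ x ∈ w := by
  classical
  rw [cnt_mk, List.count_pos_iff]

theorem mem_of_mk_eq (hD : ∀ x, D x x) {x : α} {u v : List α} (h : mk D u = mk D v) (hx : x ∈ u) : x ∈ v :=
  (cnt_mk_pos hD).1 (h ▸ (cnt_mk_pos hD).2 hx)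

theorem cnt_mul (x : α) (s t : Trace D) : cnt hD x (s * t) = cnt hD x s + cnt hD x t := by
  simp [cnt, proj_mul]

theorem cnt_one (x : α) : cnt hD x (1 : Trace D) = 0 := by
  classical
  rw [← mk_nil, cnt_mk, List.count_nil]

theorem cnt_pow (x : α) (s : Trace D) (n : ℕ) : cnt hD x (s ^ n) = n * cnt hD x s := by
  induction n with
  | zero => simp [cnt_one]
  | succ n ih => rw [pow_succ, cnt_mul, ih, Nat.succ_mul]

open Classical in
theorem count_proj {x y z : α} (d : D x y) (hz : z = x ∨ z = y) (t : Trace D) :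
    (proj d t).count z = cnt hD z t := by
  obtain ⟨w, rfl⟩ := mk_surjective t
  rw [cnt_mk, proj_mk, wordProj, List.count_filter (by simpa using hz)]

theorem cnt_le_of_dvd (x : α) {s t : Trace D} (h : s ∣ t) : cnt hD x s ≤ cnt hD x t := by
  obtain ⟨r, rfl⟩ := h
  rw [cnt_mul]
  exact Nat.le_add_right _ _

theorem eq_one_of_cnt {t : Trace D} (h : ∀ x, cnt hD x t = 0) : t = 1 := by
  classical
  obtain ⟨w, rfl⟩ := mk_surjective t
  simp only [cnt_mk, List.count_eq_zero] at h
  rw [List.eq_nil_iff_forall_not_mem.2 h, mk_nil]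

/-- Every left divisor of a trace is determined, together with the divisibility order, by its
letter counts. -/
theorem dvd_of_cnt_le (hs : ∀ x y, D x y → D y x) {p q t : Trace D} (hp : p ∣ t) (hq : q ∣ t)
    (h : ∀ x, cnt hD x p ≤ cnt hD x q) : p ∣ q := by
  classical
  obtain ⟨u, rfl⟩ := mk_surjective p
  induction u generalizing q t with
  | nil => exact ⟨q, (one_mul q).symm⟩
  | cons x u ih =>
    obtain ⟨v, rfl⟩ := mk_surjective q
    have hxv : x ∈ v := by
      have := h x
      rw [cnt_mk, cnt_mk, List.count_cons_self] at this
      exact List.count_pos_iff.1 (by omega)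
    obtain ⟨v₁, v₂, rfl, hx⟩ := List.eq_append_cons_of_mem hxv
    obtain ⟨r, hr⟩ := hp
    obtain ⟨r', hr'⟩ := hq
    obtain ⟨r, rfl⟩ := mk_surjective r
    obtain ⟨r', rfl⟩ := mk_surjective r'
    -- As `x` can also begin `t`, everything before its first occurrence in `q` is independent of
    -- it; so `x` moves to the front of `q` and cancels.
    have e : mk D (x :: (u ++ r)) = mk D (v₁ ++ x :: (v₂ ++ r')) := by
      rw [← List.cons_append, mk_append, ← hr, hr', ← mk_append]
      simp
    have hi := indep_of_mk_cons_eq e hx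
    rw [mk_append_cons_of_indep hD hs _ hi] at e
    rw [mk_append_cons_of_indep hD hs _ hi] at h ⊢
    rw [mk_cons, mk_cons x (v₁ ++ _)] at e
    rw [mk_cons, mk_cons x (v₁ ++ _)]
    refine mul_dvd_mul_left _ (ih (t := mk D (u ++ r)) ⟨mk D r', ?_⟩
      ⟨mk D r, mk_append _ _⟩ fun z => ?_)
    · rw [mul_left_cancel e, ← mk_append, List.append_assoc]
    · have := h z
      rw [mk_cons, mk_cons x (v₁ ++ _), cnt_mul, cnt_mul] at this
      omega

theorem eq_of_cnt_eq (hs : ∀ x y, D x y → D y x) {p q t : Trace D} (hp : p ∣ t) (hq : q ∣ t)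
    (h : ∀ x, cnt hD x p = cnt hD x q) : p = q := by
  obtain ⟨r, rfl⟩ := dvd_of_cnt_le hD hs hp hq fun x => (h x).le
  rw [eq_one_of_cnt hD (t := r), mul_one]
  intro x
  have := h x
  rw [cnt_mul] at this
  omega

/-- For dependent letters, the left divisors of a trace are linearly ordered. -/
theorem cnt_le_of_cnt_lt {p q t : Trace D} (hp : p ∣ t) (hq : q ∣ t) {x y : α} (d : D x y)
    (h : cnt hD x q < cnt hD x p) : cnt hD y q ≤ cnt hD y p := by
  classical
  obtain ⟨r, rfl⟩ := hp
  obtain ⟨r', hr⟩ := hq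
  have e := congrArg (proj d) hr
  rw [proj_mul, proj_mul] at e
  rw [← count_proj hD d (Or.inl rfl), ← count_proj hD d (Or.inl rfl)] at h
  rw [← count_proj hD d (Or.inr rfl), ← count_proj hD d (Or.inr rfl)]
  -- Both projections are prefixes of the projection of `t`, hence comparable; the strict inequality
  -- at `x` decides which is shorter.
  rcases List.prefix_or_prefix_of_prefix (List.prefix_append (proj d p) (proj d r))
    (e ▸ List.prefix_append (proj d q) (proj d r')) with h' | h'
  · exact absurd (h'.sublist.count_le x) (by omega)
  · exact h'.sublist.count_le y

/-- The length of a trace. -/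
noncomputable def len [Fintype α] (t : Trace D) : ℕ := ∑ x, cnt hD x t

variable [Fintype α]

theorem len_mk (w : List α) : len hD (mk D w) = w.length := by
  classical
  simp only [len, cnt_mk]
  simpa using Multiset.sum_count_eq_card (s := Finset.univ) (m := (w : Multiset α))
    (fun a _ => Finset.mem_univ a)

theorem len_mul (s t : Trace D) : len hD (s * t) = len hD s + len hD t := by
  simp [len, cnt_mul, Finset.sum_add_distrib]

theorem len_pow (s : Trace D) (n : ℕ) : len hD (s ^ n) = n * len hD s := by
  simp [len, cnt_pow, Finset.mul_sum]

theorem len_le_of_dvd {s t : Trace D} (h : s ∣ t) : len hD s ≤ len hD t :=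
  Finset.sum_le_sum fun x _ => cnt_le_of_dvd hD x h

theorem len_pos {t : Trace D} (h : t ≠ 1) : 0 < len hD t := by
  by_contra hl
  refine h (eq_one_of_cnt hD fun x => ?_)
  have : cnt hD x t ≤ len hD t :=
    Finset.single_le_sum (f := fun x => cnt hD x t) (fun _ _ => Nat.zero_le _) (Finset.mem_univ x)
  omega

end Count

/-! ### Commuting traces -/

/-- The projections commute in a free monoid. Raised to the powers `b` and `a` they have equal
length, so they coincide and their letter counts can be compared. -/
theorem cnt_mul_cnt_of_commute (hD : ∀ x, D x x) {g₁ g₂ : Trace D} (h : Commute g₁ g₂)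
    {x y : α} (d : D x y) :
    cnt hD x g₁ * cnt hD y g₂ = cnt hD y g₁ * cnt hD x g₂ := by
  classical
  set a := (proj d g₁).length with ha
  set b := (proj d g₂).length with hb
  have hlen : ∀ (g : Trace D) (n : ℕ), (proj d (g ^ n)).length = n * (proj d g).length := by
    intro g n
    induction n with
    | zero => simp [← mk_nil, proj_mk, wordProj]
    | succ n ih => rw [pow_succ, proj_mul, List.length_append, ih, Nat.succ_mul]
  have e := congrArg (proj d) (h.pow_pow b a).eq
  rw [proj_mul, proj_mul] at e
  have e' := (List.append_inj e (by rw [hlen, hlen, mul_comm])).1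
  have hx := congrArg (List.count x) e'
  have hy := congrArg (List.count y) e'
  rw [count_proj hD d (Or.inl rfl), count_proj hD d (Or.inl rfl), cnt_pow, cnt_pow] at hx
  rw [count_proj hD d (Or.inr rfl), count_proj hD d (Or.inr rfl), cnt_pow, cnt_pow] at hy
  rcases Nat.eq_zero_or_pos a with h0 | h0
  · have h1 : proj d g₁ = [] := List.length_eq_zero_iff.1 h0
    rw [← count_proj hD d (Or.inl rfl) g₁, ← count_proj hD d (Or.inr rfl) g₁, h1]
    simp
  · apply Nat.eq_of_mul_eq_mul_left h0
    calc a * (cnt hD x g₁ * cnt hD y g₂) = cnt hD x g₁ * (a * cnt hD y g₂) := by ring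
      _ = cnt hD y g₁ * (b * cnt hD x g₁) := by rw [← hy]; ring
      _ = a * (cnt hD y g₁ * cnt hD x g₂) := by rw [hx]; ring

/-- Commuting traces with proportional letter counts are powers of a common trace. -/
theorem exists_common_root [Fintype α] (hD : ∀ x, D x x) (hs : ∀ x y, D x y → D y x) (n : ℕ) :
    ∀ g₁ g₂ : Trace D, len hD g₁ + len hD g₂ ≤ n → Commute g₁ g₂ →
      (∀ x y, cnt hD x g₁ * cnt hD y g₂ = cnt hD y g₁ * cnt hD x g₂) →
      ∃ (w : Trace D) (i j : ℕ), g₁ = w ^ i ∧ g₂ = w ^ j := by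
  induction n using Nat.strong_induction_on with
  | _ n ih =>
  have key : ∀ g₁ g₂ : Trace D, len hD g₁ + len hD g₂ ≤ n → Commute g₁ g₂ → g₁ ≠ 1 →
      (∀ x y, cnt hD x g₁ * cnt hD y g₂ = cnt hD y g₁ * cnt hD x g₂) →
      (∀ x, cnt hD x g₁ ≤ cnt hD x g₂) →
      ∃ (w : Trace D) (i j : ℕ), g₁ = w ^ i ∧ g₂ = w ^ j := by
    intro g₁ g₂ hn hc h1 hp hle
    -- A step of the Euclidean algorithm: `g₁` and `g₂` both divide `g₁ * g₂`, so `g₂ = g₁ * g₃`,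
    -- and `g₁`, `g₃` inherit commutation and proportionality.
    obtain ⟨g₃, rfl⟩ := dvd_of_cnt_le hD hs (Dvd.intro _ rfl) (Dvd.intro _ hc.eq.symm) hle
    have h1' := len_pos hD h1
    rw [len_mul] at hn
    obtain ⟨w, i, j, rfl, rfl⟩ := ih (len hD g₁ + len hD g₃) (by omega) g₁ g₃ le_rfl
      (mul_left_cancel (a := g₁) (by rw [← mul_assoc, ← mul_assoc]; simpa [mul_assoc] using hc.eq))
      (fun x y => by
        have := hp x y
        rw [cnt_mul, cnt_mul] at this
        nlinarith)
    exact ⟨w, i, i + j, rfl, (pow_add _ _ _).symm⟩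
  intro g₁ g₂ hn hc hp
  by_cases h1 : g₁ = 1
  · exact ⟨g₂, 0, 1, by simpa using h1, by simp⟩
  by_cases h2 : g₂ = 1
  · exact ⟨g₁, 1, 0, by simp, by simpa using h2⟩
  obtain ⟨x, hx⟩ : ∃ x, cnt hD x g₁ ≠ 0 := by
    by_contra! h
    exact h1 (eq_one_of_cnt hD h)
  have hx := Nat.pos_of_ne_zero hx
  rcases le_total (cnt hD x g₁) (cnt hD x g₂) with h | h
  · refine key g₁ g₂ hn hc h1 hp fun y => Nat.le_of_mul_le_mul_left ?_ hx
    rw [hp x y, mul_comm]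
    exact Nat.mul_le_mul_left _ h
  · obtain ⟨w, i, j, e₁, e₂⟩ := key g₂ g₁ (by omega) hc.symm h2 (fun x y => by
      rw [mul_comm, hp y x, mul_comm]) fun y => by
        refine Nat.le_of_mul_le_mul_left ?_ hx
        rw [hp x y, mul_comm (cnt hD x g₁)]
        exact Nat.mul_le_mul_left _ h
    exact ⟨w, j, i, e₂, e₁⟩

/-! ### Traces with dominating connected support -/

/-- The letters `x` and `y` are joined by a chain of dependent letters with `i` interior letters,
all of which occur in `g`. -/
def Linked (hD : ∀ x, D x x) (g : Trace D) : ℕ → α → α → Prop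
  | 0, x, y => D x y
  | i + 1, x, y => ∃ z, 0 < cnt hD z g ∧ D x z ∧ Linked hD g i z y

/-- Any two letters are linked by at most `k` letters of `g`. -/
def Spans (hD : ∀ x, D x x) (k : ℕ) (g : Trace D) : Prop :=
  ∀ x y, ∃ i ≤ k, Linked hD g i x y

variable (hD : ∀ x, D x x)

theorem Linked.congr {g g' : Trace D} (h : ∀ x, cnt hD x g = cnt hD x g') {i : ℕ} {x y : α}
    (hl : Linked hD g i x y) : Linked hD g' i x y := by
  induction i generalizing x with
  | zero => exact hl
  | succ i ih =>
    obtain ⟨z, hz, d, hl⟩ := hl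
    exact ⟨z, h z ▸ hz, d, ih hl⟩

theorem Linked.proportional {g₁ g₂ : Trace D} (h : Commute g₁ g₂) {i : ℕ} {x y : α}
    (hl : Linked hD g₁ i x y) :
    cnt hD x g₁ * cnt hD y g₂ = cnt hD y g₁ * cnt hD x g₂ := by
  induction i generalizing x with
  | zero => exact cnt_mul_cnt_of_commute hD h hl
  | succ i ih =>
    obtain ⟨z, hz, d, hl⟩ := hl
    have e₁ := cnt_mul_cnt_of_commute hD h d
    have e₂ := ih hl
    apply Nat.eq_of_mul_eq_mul_left hz
    calc _ = cnt hD x g₁ * (cnt hD z g₁ * cnt hD y g₂) := by ring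
      _ = cnt hD y g₁ * (cnt hD x g₁ * cnt hD z g₂) := by rw [e₂]; ring
      _ = _ := by rw [e₁]; ring

/-- An excess of `p` at one letter passes to a dependent letter `z` as a weak inequality. Giving up
one factor `g`, which contains `z`, makes it strict again, so the chain can be followed to its end.
-/
theorem Linked.cnt_le {g a p t : Trace D} {i j : ℕ} {x y : α} (hl : Linked hD g i x y)
    (hp : p ∣ t) (ht : a * g ^ (j + i) ∣ t) (hx : cnt hD x (a * g ^ (j + i)) < cnt hD x p) :
    cnt hD y (a * g ^ j) ≤ cnt hD y p := by
  induction i generalizing x with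
  | zero => exact cnt_le_of_cnt_lt hD hp ht hl hx
  | succ i ih =>
    obtain ⟨z, hz, d, hl⟩ := hl
    have h := cnt_le_of_cnt_lt hD hp ht d hx
    have e : a * g ^ (j + (i + 1)) = a * g ^ (j + i) * g := by
      rw [← add_assoc, pow_succ, mul_assoc]
    rw [e] at h ht
    rw [cnt_mul _ _ (a * g ^ (j + i))] at h
    exact ih hl ((Dvd.intro _ rfl).trans ht) (by omega)

/-- Left divisors of a trace are almost comparable with the left divisors cut out by the powers
of a factor with dominating connected support. -/
theorem Spans.dvd_or_dvd (hs : ∀ x y, D x y → D y x) {k : ℕ} {g : Trace D} (hg : Spans hD k g)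
    {a p t : Trace D} {j : ℕ} (hp : p ∣ t) (ht : a * g ^ (j + k) ∣ t) :
    p ∣ a * g ^ (j + k) ∨ a * g ^ j ∣ p := by
  by_cases h : ∀ x, cnt hD x p ≤ cnt hD x (a * g ^ (j + k))
  · exact Or.inl (dvd_of_cnt_le hD hs hp ht h)
  push Not at h
  obtain ⟨x, hx⟩ := h
  have hjk : a * g ^ j ∣ a * g ^ (j + k) := mul_dvd_mul_left _ (pow_dvd_pow _ (by omega))
  refine Or.inr (dvd_of_cnt_le hD hs (hjk.trans ht) hp fun y => ?_)
  obtain ⟨i, hi, hl⟩ := hg x y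
  have hik : a * g ^ (j + i) ∣ a * g ^ (j + k) := mul_dvd_mul_left _ (pow_dvd_pow _ (by omega))
  exact hl.cnt_le hD hp (hik.trans ht) ((cnt_le_of_dvd hD x hik).trans_lt hx)

end Trace

end Traces

/-! ### Two periodic factorisations of one trace -/

namespace Trace

variable {α : Type*} {D : α → α → Prop}

/-- Both `s` and `g * s` divide `g ^ (l + 1)`, so comparing counts gives `s ∣ g * s`. -/
theorem exists_conj_of_dvd_pow (hD : ∀ x, D x x) (hs : ∀ x y, D x y → D y x) {g s : Trace D} {l : ℕ}
    (h : s ∣ g ^ l) : ∃ g', g * s = s * g' := by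
  have h₁ : s ∣ g ^ (l + 1) := h.trans (pow_dvd_pow _ (Nat.le_succ l))
  have h₂ : g * s ∣ g ^ (l + 1) := pow_succ' g l ▸ mul_dvd_mul_left g h
  exact dvd_of_cnt_le hD hs h₁ h₂ fun x => by rw [cnt_mul]; exact Nat.le_add_left _ _

variable (hD : ∀ x, D x x)

/-- Two powers sharing a long left divisor: their bases are powers of a common trace. -/
theorem exists_common_root_of_pow_mul_eq [Fintype α] (hs : ∀ x y, D x y → D y x) {k n m : ℕ}
    {g₁ g₂ b₁ b₂ : Trace D} (hg₁ : Spans hD k g₁) (hg₂ : Spans hD k g₂)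
    (e : g₁ ^ (n + k + 1) * b₁ = g₂ ^ (m + k + 1) * b₂)
    (hn : len hD g₂ < n * len hD g₁) (hm : len hD g₁ < m * len hD g₂) :
    ∃ (w : Trace D) (i j : ℕ), g₁ = w ^ i ∧ g₂ = w ^ j := by
  -- Applied both ways, this makes `g₁ * g₂` and `g₂ * g₁` left divisors of the same trace with
  -- equal counts, so `g₁` and `g₂` commute.
  have key : ∀ {g g' b : Trace D} {n : ℕ}, Spans hD k g → g' ∣ g ^ (n + k + 1) * b →
      len hD g' < n * len hD g → g * g' ∣ g ^ (n + k + 1) * b := by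
    intro g g' b n hg h hl
    have h' : g' ∣ g ^ (n + k) := by
      rcases hg.dvd_or_dvd hD hs (a := 1) (j := n) h
        (by rw [one_mul]; exact (pow_dvd_pow _ (Nat.le_succ _)).trans (Dvd.intro _ rfl)) with h | h
      · rwa [one_mul] at h
      · have := len_le_of_dvd hD h
        rw [one_mul, len_pow] at this
        omega
    rw [pow_succ' g (n + k)]
    exact (mul_dvd_mul_left g h').trans (Dvd.intro _ rfl)
  have h₁ : g₁ ∣ g₂ ^ (m + k + 1) * b₂ := by
    rw [← e, pow_succ', mul_assoc]
    exact Dvd.intro _ rfl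
  have h₂ : g₂ ∣ g₁ ^ (n + k + 1) * b₁ := by
    rw [e, pow_succ', mul_assoc]
    exact Dvd.intro _ rfl
  have hc : Commute g₁ g₂ := by
    refine eq_of_cnt_eq hD hs (key hg₁ h₂ hn) (e ▸ key hg₂ h₁ hm) fun x => ?_
    rw [cnt_mul, cnt_mul, add_comm]
  refine exists_common_root hD hs _ g₁ g₂ le_rfl hc fun x y => ?_
  obtain ⟨i, -, hl⟩ := hg₁ x y
  exact hl.proportional hD hc

/-- Write `a₁ * g₁ ^ k = a₂ * s`. Cancelling `a₂` leaves `s` as a beginning of `g₂ ^ m * b₂`; it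
lies in a power of `g₂`, so it conjugates `g₂` to some `g₂'`. Cancelling `s` as well leaves powers
of `g₁` and `g₂'` starting together. -/
theorem exists_common_root_of_dvd [Fintype α] (hs : ∀ x y, D x y → D y x) {k n m : ℕ}
    {a₁ g₁ b₁ a₂ g₂ b₂ : Trace D} (hg₁ : Spans hD k g₁) (hg₂ : Spans hD k g₂)
    (e : a₁ * g₁ ^ n * b₁ = a₂ * g₂ ^ m * b₂) {M : ℝ}
    (ha₁ : len hD a₁ ≤ M) (hb₁ : len hD b₁ ≤ M) (hb₂ : len hD b₂ ≤ M)
    (h₁ : (3 * k + 5) * (len hD g₁ : ℝ) < len hD (a₁ * g₁ ^ n * b₁) - 2 * M)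
    (h₂ : (3 * k + 5) * (len hD g₂ : ℝ) < len hD (a₁ * g₁ ^ n * b₁) - 2 * M)
    (hd : a₂ ∣ a₁ * g₁ ^ k) :
    ∃ (s g₂' w : Trace D) (i j : ℕ), g₂ * s = s * g₂' ∧ g₁ = w ^ i ∧ g₂' = w ^ j := by
  obtain ⟨s, hs₁⟩ := hd
  have L₁ : (len hD (a₁ * g₁ ^ n * b₁) : ℝ) = len hD a₁ + n * len hD g₁ + len hD b₁ := by
    rw [len_mul, len_mul, len_pow]; push_cast; ring
  have L₂ : (len hD (a₁ * g₁ ^ n * b₁) : ℝ) = len hD a₂ + m * len hD g₂ + len hD b₂ := by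
    rw [e, len_mul, len_mul, len_pow]; push_cast; ring
  have Ls : (len hD a₁ : ℝ) + k * len hD g₁ = len hD a₂ + len hD s := by
    have := congrArg (len hD) hs₁
    rw [len_mul, len_mul, len_pow] at this
    exact_mod_cast this
  set L : ℝ := (len hD (a₁ * g₁ ^ n * b₁) : ℝ)
  have p₁ : (0 : ℝ) ≤ len hD g₁ := Nat.cast_nonneg _
  have p₂ : (0 : ℝ) ≤ len hD g₂ := Nat.cast_nonneg _
  have q₁ : (0 : ℝ) ≤ k * len hD g₁ := by positivity
  have q₂ : (0 : ℝ) ≤ k * len hD g₂ := by positivity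
  have r₂ : (0 : ℝ) ≤ len hD a₂ := Nat.cast_nonneg _
  obtain ⟨c, rfl⟩ : ∃ c, n = k + (c + k + 1) := by
    refine Nat.exists_eq_add_of_le (?_ : k + k + 1 ≤ n) |>.imp fun c hc => by omega
    by_contra! hlt
    have : (n : ℝ) * len hD g₁ ≤ (k + k + 1) * len hD g₁ :=
      mul_le_mul_of_nonneg_right (by exact_mod_cast hlt.le) p₁
    linarith
  have hsm : s * (g₁ ^ (c + k + 1) * b₁) = g₂ ^ m * b₂ := by
    apply mul_left_cancel (a := a₂)
    rw [← mul_assoc a₂ s, ← hs₁, ← mul_assoc a₂, ← e, pow_add g₁ k]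
    simp only [mul_assoc]
  have hsd : s ∣ g₂ ^ m * b₂ := hsm ▸ Dvd.intro _ rfl
  have hkm : k ≤ m := by
    by_contra! hlt
    have : (m : ℝ) * len hD g₂ ≤ k * len hD g₂ :=
      mul_le_mul_of_nonneg_right (by exact_mod_cast hlt.le) p₂
    linarith
  have dvd_or : ∀ j, j + k ≤ m → s ∣ g₂ ^ (j + k) ∨ g₂ ^ j ∣ s := by
    intro j hj
    simpa using hg₂.dvd_or_dvd hD hs (a := 1) (j := j) hsd
      (by rw [one_mul]; exact (pow_dvd_pow _ hj).trans (Dvd.intro _ rfl))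
  have hex : ∃ l, s ∣ g₂ ^ l := by
    refine ⟨m, ?_⟩
    obtain ⟨j, rfl⟩ := Nat.exists_eq_add_of_le' hkm
    refine (dvd_or j le_rfl).resolve_right fun h => ?_
    have := len_le_of_dvd hD h
    rw [len_pow] at this
    have : (j : ℝ) * len hD g₂ ≤ len hD s := by exact_mod_cast this
    push_cast at L₂
    linarith
  classical
  -- Only about `len s` plus `k + 1` copies of `g₂` may be used up, so that a high power of `g₂'`
  -- survives. The least exponent works, unless `k` already does.
  obtain ⟨l, hl, hlm, hlen⟩ : ∃ l, s ∣ g₂ ^ l ∧ l ≤ m ∧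
      (l : ℝ) * len hD g₂ ≤ (k + 1) * len hD g₂ + len hD s := by
    by_cases hk : s ∣ g₂ ^ k
    · refine ⟨k, hk, hkm, ?_⟩
      have : (0 : ℝ) ≤ len hD s := Nat.cast_nonneg _
      linarith
    have hkl : k < Nat.find hex := by
      by_contra! h
      exact hk ((Nat.find_spec hex).trans (pow_dvd_pow _ h))
    obtain ⟨j, hj⟩ := Nat.exists_eq_add_of_lt hkl
    have hmin : ¬ s ∣ g₂ ^ (j + k) := Nat.find_min hex (by omega)
    have hjm : j + k < m := by
      by_contra! h
      obtain ⟨j', rfl⟩ := Nat.exists_eq_add_of_le' hkm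
      rcases dvd_or j' le_rfl with h' | h'
      · exact hmin (h'.trans (pow_dvd_pow _ h))
      · have := len_le_of_dvd hD h'
        rw [len_pow] at this
        have : (j' : ℝ) * len hD g₂ ≤ len hD s := by exact_mod_cast this
        push_cast at L₂
        linarith
    refine ⟨Nat.find hex, Nat.find_spec hex, by omega, ?_⟩
    have := len_le_of_dvd hD ((dvd_or j hjm.le).resolve_left hmin)
    rw [len_pow] at this
    have : (j : ℝ) * len hD g₂ ≤ len hD s := by exact_mod_cast this
    rw [hj]
    push_cast
    linarith
  obtain ⟨g₂', hconj⟩ := exists_conj_of_dvd_pow hD hs hl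
  obtain ⟨q, hq⟩ := hl
  have hcnt : ∀ x, cnt hD x g₂ = cnt hD x g₂' := fun x => by
    have := congrArg (cnt hD x) hconj
    rw [cnt_mul, cnt_mul] at this
    omega
  have hlen' : len hD g₂' = len hD g₂ := Finset.sum_congr rfl fun x _ => (hcnt x).symm
  have hg₂' : Spans hD k g₂' := fun x y =>
    (hg₂ x y).imp fun i hi => ⟨hi.1, hi.2.congr hD hcnt⟩
  obtain ⟨d, rfl⟩ := Nat.exists_eq_add_of_le' hlm
  -- The most demanding estimate: it needs `(k + 1) * |g₁| + (2 * k + 2) * |g₂|` below `L - 2 * M`,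
  -- which the factor `3 * k + 5` covers.
  have hd : len hD g₁ + (k + 1) * len hD g₂ < d * len hD g₂ := by
    have : (len hD g₁ : ℝ) + (k + 1) * len hD g₂ < d * len hD g₂ := by
      push_cast at L₂
      linarith
    exact_mod_cast this
  obtain ⟨d, rfl⟩ : ∃ d', d = d' + k + 1 := by
    have : k + 1 ≤ d := by
      by_contra! hlt
      have := Nat.mul_le_mul_right (len hD g₂) hlt.le
      omega
    exact (Nat.exists_eq_add_of_le' this).imp fun c hc => by omega
  have hpow : ∀ j : ℕ, g₂ ^ j * s = s * g₂' ^ j := fun j => by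
    induction j with
    | zero => simp
    | succ j ih => rw [pow_succ', mul_assoc, ih, ← mul_assoc, hconj, mul_assoc, ← pow_succ']
  have e' : g₁ ^ (c + k + 1) * b₁ = g₂' ^ (d + k + 1) * (q * b₂) := by
    apply mul_left_cancel (a := s)
    rw [hsm, pow_add, hq, ← mul_assoc _ s q, hpow]
    simp only [mul_assoc]
  obtain ⟨w, i, j, hw⟩ := exists_common_root_of_pow_mul_eq hD hs hg₁ hg₂' e' (by
      rw [hlen']
      have : (len hD g₂ : ℝ) < c * len hD g₁ := by
        push_cast at L₁
        linarith
      exact_mod_cast this) (by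
      rw [hlen']
      have : (d + k + 1) * len hD g₂ = d * len hD g₂ + (k + 1) * len hD g₂ := by ring
      omega)
  exact ⟨s, g₂', w, i, j, hconj, hw⟩

/-- If a trace is filled by high powers of two traces with dominating connected supports, except
for two ends that do not make up the whole trace, then these two traces are, up to conjugacy,
powers of a common trace. -/
theorem exists_common_root_of_eq [Fintype α] (hs : ∀ x y, D x y → D y x) {k n m : ℕ}
    {a₁ g₁ b₁ a₂ g₂ b₂ : Trace D} (hg₁ : Spans hD k g₁) (hg₂ : Spans hD k g₂)
    (e : a₁ * g₁ ^ n * b₁ = a₂ * g₂ ^ m * b₂) {M : ℝ}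
    (ha₁ : len hD a₁ ≤ M) (hb₁ : len hD b₁ ≤ M) (ha₂ : len hD a₂ ≤ M) (hb₂ : len hD b₂ ≤ M)
    (h₁ : (3 * k + 5) * (len hD g₁ : ℝ) < len hD (a₁ * g₁ ^ n * b₁) - 2 * M)
    (h₂ : (3 * k + 5) * (len hD g₂ : ℝ) < len hD (a₁ * g₁ ^ n * b₁) - 2 * M) (hkn : k ≤ n) :
    (∃ (s g₂' w : Trace D) (i j : ℕ), g₂ * s = s * g₂' ∧ g₁ = w ^ i ∧ g₂' = w ^ j) ∨
    (∃ (s g₁' w : Trace D) (i j : ℕ), g₁ * s = s * g₁' ∧ g₂ = w ^ i ∧ g₁' = w ^ j) := by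
  have hp : a₂ ∣ a₁ * g₁ ^ n * b₁ := by
    rw [e, mul_assoc]
    exact Dvd.intro _ rfl
  have ht : a₁ * g₁ ^ (0 + k) ∣ a₁ * g₁ ^ n * b₁ :=
    (mul_dvd_mul_left _ (pow_dvd_pow _ (by omega))).trans (Dvd.intro _ rfl)
  -- With `j = 0` the alternatives are `a₂ ∣ a₁ * g₁ ^ k` and `a₁ ∣ a₂`; the second is the first
  -- with the roles exchanged.
  rcases hg₁.dvd_or_dvd hD hs hp ht with h | h
  · rw [zero_add] at h
    exact Or.inl (exists_common_root_of_dvd hD hs hg₁ hg₂ e ha₁ hb₁ hb₂ h₁ h₂ h)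
  · rw [pow_zero, mul_one] at h
    rw [e] at h₁ h₂
    exact Or.inr (exists_common_root_of_dvd hD hs hg₂ hg₁ e.symm ha₂ hb₂ hb₁ h₂ h₁
      (h.trans (Dvd.intro _ rfl)))

end Trace

namespace RAAG

open Trace

variable {V : Type*} (Γ : SimpleGraph V)

/-! ### Traces and right-angled Artin groups -/

/-- Two letters are dependent if their vertices are equal or adjacent. -/
def dep (x y : V × Bool) : Prop := x.1 = y.1 ∨ Γ.Adj x.1 y.1

theorem dep_refl (x : V × Bool) : dep Γ x x := Or.inl rfl

theorem dep_symm (x y : V × Bool) (h : dep Γ x y) : dep Γ y x :=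
  h.imp Eq.symm SimpleGraph.Adj.symm

/-- The inverse letter. -/
def letterInv (x : V × Bool) : V × Bool := (x.1, !x.2)

theorem letterInv_letterInv (x : V × Bool) : letterInv (letterInv x) = x := by
  simp [letterInv]

/-- The trace of a letter. -/
def letter (x : V × Bool) : Trace (dep Γ) := Trace.mk (dep Γ) [x]

variable {Γ}

theorem letter_comm {x y : V × Bool} (h : ¬ dep Γ x y) (t : Trace (dep Γ)) :
    letter Γ x * (letter Γ y * t) = letter Γ y * (letter Γ x * t) := by
  obtain ⟨w, rfl⟩ := mk_surjective t
  exact (mk_append_cons_of_indep (dep_refl Γ) (dep_symm Γ) (u := [y]) w (by simpa using h)).symm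

/-- Levi's lemma for single letters, the tool for all cancellation arguments below. -/
theorem levi {x y : V × Bool} {s r : Trace (dep Γ)} (h : letter Γ x * s = letter Γ y * r)
    (hxy : x ≠ y) : ¬ dep Γ x y ∧ ∃ u, s = letter Γ y * u ∧ r = letter Γ x * u := by
  obtain ⟨s, rfl⟩ := mk_surjective s
  obtain ⟨r, rfl⟩ := mk_surjective r
  have hx : x ∈ r := (List.mem_cons.1 (mem_of_mk_eq (dep_refl Γ) (u := x :: s) (v := y :: r) h
    List.mem_cons_self)).resolve_left hxy
  classical
  obtain ⟨r₁, r₂, rfl, hr⟩ := List.eq_append_cons_of_mem hx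
  have e : Trace.mk (dep Γ) (x :: s) = Trace.mk (dep Γ) ((y :: r₁) ++ x :: r₂) := h
  have hi := indep_of_mk_cons_eq e (by simp [hxy, hr])
  refine ⟨hi y List.mem_cons_self, Trace.mk _ (r₁ ++ r₂), ?_, ?_⟩
  · rw [mk_append_cons_of_indep (dep_refl Γ) (dep_symm Γ) _ hi] at e
    exact mul_left_cancel (a := letter Γ x) e
  · exact mk_append_cons_of_indep (dep_refl Γ) (dep_symm Γ) _
      fun z hz => hi z (List.mem_cons_of_mem _ hz)

theorem eval_append (u v : List (V × Bool)) : eval Γ (u ++ v) = eval Γ u * eval Γ v := by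
  simp only [eval, ← FreeGroup.mul_mk, map_mul]

theorem gen_comm {v w : V} (h : ¬ Γ.Adj v w) : Commute (gen Γ v) (gen Γ w) := by
  have := PresentedGroup.one_of_mem (rels := rels Γ) ⟨v, w, h, rfl⟩
  simp only [map_mul, map_inv] at this
  rwa [mul_inv_eq_one, mul_inv_eq_iff_eq_mul] at this

theorem eval_true (v : V) : eval Γ [(v, true)] = gen Γ v := rfl

theorem eval_false (v : V) : eval Γ [(v, false)] = (gen Γ v)⁻¹ := rfl

theorem eval_letter_comm {x y : V × Bool} (h : ¬ dep Γ x y) :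
    Commute (eval Γ [x]) (eval Γ [y]) := by
  have hc : Commute (gen Γ x.1) (gen Γ y.1) := gen_comm fun h' => h (Or.inr h')
  obtain ⟨v, _ | _⟩ := x <;> obtain ⟨w, _ | _⟩ := y <;>
    simp only [eval_true, eval_false, Commute.inv_left_iff, Commute.inv_right_iff] <;> exact hc

theorem eval_append_cons_of_indep {x : V × Bool} {u : List (V × Bool)} (v : List (V × Bool))
    (h : ∀ z ∈ u, ¬ dep Γ x z) : eval Γ (u ++ x :: v) = eval Γ (x :: (u ++ v)) := by
  induction u with
  | nil => rfl
  | cons y u ih =>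
    have e := ih fun z hz => h z (List.mem_cons_of_mem _ hz)
    have c := eval_letter_comm (h y List.mem_cons_self)
    rw [List.cons_append, ← List.singleton_append, eval_append, e,
      ← List.singleton_append (l := u ++ v), eval_append, ← mul_assoc, ← c.eq, mul_assoc,
      ← eval_append, ← eval_append]
    rfl

theorem eval_eq_of_mk_eq {u v : List (V × Bool)} (h : Trace.mk (dep Γ) u = Trace.mk (dep Γ) v) :
    eval Γ u = eval Γ v := by
  classical
  induction u generalizing v with
  | nil =>
    rw [List.eq_nil_iff_forall_not_mem.2 fun x hx =>
      List.not_mem_nil (mem_of_mk_eq (dep_refl Γ) h.symm hx)]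
  | cons x u ih =>
    have hx : x ∈ v := mem_of_mk_eq (dep_refl Γ) h List.mem_cons_self
    obtain ⟨v₁, v₂, rfl, hv⟩ := List.eq_append_cons_of_mem hx
    have hi := indep_of_mk_cons_eq h hv
    rw [mk_append_cons_of_indep (dep_refl Γ) (dep_symm Γ) _ hi] at h
    rw [eval_append_cons_of_indep _ hi, ← List.singleton_append, eval_append,
      ih (mul_left_cancel (a := letter Γ x) h), ← eval_append]
    rfl

/-- The group element represented by a trace. -/
def evalTrace (Γ : SimpleGraph V) : Trace (dep Γ) →* G Γ where
  toFun := Quotient.lift (eval Γ) fun _ _ h => eval_eq_of_mk_eq (Quotient.sound h)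
  map_one' := by
    change eval Γ [] = 1
    rfl
  map_mul' s t := by
    obtain ⟨u, rfl⟩ := mk_surjective s
    obtain ⟨v, rfl⟩ := mk_surjective t
    exact eval_append u v

theorem evalTrace_mk (w : List (V × Bool)) : evalTrace Γ (Trace.mk _ w) = eval Γ w := rfl

theorem eval_mul_letterInv (x : V × Bool) : eval Γ [x] * eval Γ [letterInv x] = 1 := by
  obtain ⟨v, _ | _⟩ := x <;> simp [letterInv, eval_true, eval_false]

/-! ### The action on freely reduced traces -/

/-- A trace is freely reduced if it has no factor `x x⁻¹`. -/
def FreelyReduced (t : Trace (dep Γ)) : Prop :=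
  ¬ ∃ p x q, t = p * (letter Γ x * (letter Γ (letterInv x) * q))

open Classical in
/-- Left multiplication by a letter, followed by cancellation. -/
noncomputable def act (x : V × Bool) (t : Trace (dep Γ)) : Trace (dep Γ) :=
  if h : ∃ s, t = letter Γ (letterInv x) * s then h.choose else letter Γ x * t

theorem act_letterInv_mul (x : V × Bool) (s : Trace (dep Γ)) :
    act x (letter Γ (letterInv x) * s) = s := by
  have h : ∃ r, letter Γ (letterInv x) * s = letter Γ (letterInv x) * r := ⟨s, rfl⟩
  rw [act, dif_pos h]
  exact (mul_left_cancel h.choose_spec).symm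

theorem act_letterInv_letter_mul (x : V × Bool) (s : Trace (dep Γ)) :
    act (letterInv x) (letter Γ x * s) = s := by
  have := act_letterInv_mul (letterInv x) s
  rwa [letterInv_letterInv] at this

theorem act_of_not {x : V × Bool} {t : Trace (dep Γ)}
    (h : ¬ ∃ s, t = letter Γ (letterInv x) * s) : act x t = letter Γ x * t := dif_neg h

theorem FreelyReduced.of_mul {s t : Trace (dep Γ)} (h : FreelyReduced (s * t)) :
    FreelyReduced t := by
  rintro ⟨p, x, q, rfl⟩
  exact h ⟨s * p, x, q, by rw [mul_assoc]⟩

theorem FreelyReduced.letter_mul {x : V × Bool} {t : Trace (dep Γ)} (ht : FreelyReduced t)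
    (h : ¬ ∃ s, t = letter Γ (letterInv x) * s) : FreelyReduced (letter Γ x * t) := by
  rintro ⟨p, y, q, e⟩
  obtain ⟨p, rfl⟩ := mk_surjective p
  induction p generalizing t with
  | nil =>
    rw [mk_nil, one_mul] at e
    by_cases hxy : x = y
    · subst hxy
      exact h ⟨q, mul_left_cancel e⟩
    obtain ⟨hi, u, rfl, hu⟩ := levi e hxy
    obtain ⟨-, u', hu', rfl⟩ := levi hu.symm (fun e' => hi (Or.inl (by rw [e']; rfl)))
    exact ht ⟨1, y, u', by rw [one_mul, hu']⟩
  | cons z p ih =>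
    rw [mk_cons, mul_assoc] at e
    by_cases hxz : x = z
    · subst hxz
      exact ht ⟨_, y, q, mul_left_cancel e⟩
    obtain ⟨hi, u, rfl, hu⟩ := levi (y := z) e hxz
    refine ih ht.of_mul ?_ hu.symm
    rintro ⟨s, rfl⟩
    exact h ⟨letter Γ z * s, (letter_comm (x := letterInv x) hi s).symm⟩

theorem FreelyReduced.act {t : Trace (dep Γ)} (ht : FreelyReduced t) (x : V × Bool) :
    FreelyReduced (act x t) := by
  by_cases h : ∃ s, t = letter Γ (letterInv x) * s
  · obtain ⟨s, rfl⟩ := h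
    rw [act_letterInv_mul]
    exact ht.of_mul
  · rw [act_of_not h]
    exact ht.letter_mul h

theorem act_act_letterInv {t : Trace (dep Γ)} (ht : FreelyReduced t) (x : V × Bool) :
    act x (act (letterInv x) t) = t := by
  by_cases h : ∃ s, t = letter Γ x * s
  · obtain ⟨s, rfl⟩ := h
    rw [act_letterInv_letter_mul, act_of_not]
    rintro ⟨r, rfl⟩
    exact ht ⟨1, x, r, (one_mul _).symm⟩
  · rw [act_of_not (x := letterInv x) (by rwa [letterInv_letterInv]), act_letterInv_mul]

theorem exists_letter_mul_iff {x y : V × Bool} (h : ¬ dep Γ x y) (s : Trace (dep Γ)) :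
    (∃ r, letter Γ y * s = letter Γ x * r) ↔ ∃ r, s = letter Γ x * r := by
  constructor
  · rintro ⟨r, hr⟩
    obtain ⟨-, u, -, hu⟩ := levi hr.symm (fun e => h (Or.inl (by rw [e])))
    exact ⟨u, hu⟩
  · rintro ⟨r, rfl⟩
    exact ⟨letter Γ y * r, (letter_comm h r).symm⟩

theorem act_comm {x y : V × Bool} (h : ¬ dep Γ x y) (t : Trace (dep Γ)) :
    act x (act y t) = act y (act x t) := by
  have h₁ : ¬ dep Γ (letterInv x) y := h
  have h₂ : ¬ dep Γ (letterInv x) (letterInv y) := h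
  have h₃ : ¬ dep Γ y x := fun h' => h (dep_symm Γ _ _ h')
  have h₄ : ¬ dep Γ (letterInv y) (letterInv x) := h₃
  have h₅ : ¬ dep Γ (letterInv y) x := h₃
  by_cases hx : ∃ s, t = letter Γ (letterInv x) * s
  · obtain ⟨s, rfl⟩ := hx
    rw [act_letterInv_mul]
    by_cases hy : ∃ r, s = letter Γ (letterInv y) * r
    · obtain ⟨r, rfl⟩ := hy
      rw [letter_comm h₂, act_letterInv_mul, act_letterInv_mul, act_letterInv_mul]
    · rw [act_of_not hy, 
        act_of_not (t := letter Γ (letterInv x) * s) (by rwa [exists_letter_mul_iff h₄]),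
        ← letter_comm h₁, act_letterInv_mul]
  · rw [act_of_not hx]
    by_cases hy : ∃ r, t = letter Γ (letterInv y) * r
    · obtain ⟨r, rfl⟩ := hy
      rw [exists_letter_mul_iff h₂] at hx
      rw [act_letterInv_mul, act_of_not hx, ← letter_comm h₅, act_letterInv_mul]
    · rw [act_of_not hy, act_of_not (by rwa [exists_letter_mul_iff h₁]),
        act_of_not (by rwa [exists_letter_mul_iff h₅]), letter_comm h]

/-- The permutation of the freely reduced traces given by a letter. -/
noncomputable def actPerm (x : V × Bool) : Equiv.Perm {t : Trace (dep Γ) // FreelyReduced t} where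
  toFun t := ⟨act x t, t.2.act x⟩
  invFun t := ⟨act (letterInv x) t, t.2.act _⟩
  left_inv t := Subtype.ext (by
    have := act_act_letterInv t.2 (letterInv x)
    rwa [letterInv_letterInv] at this)
  right_inv t := Subtype.ext (act_act_letterInv t.2 x)

/-- The action of the group on the freely reduced traces. -/
noncomputable def actHom (Γ : SimpleGraph V) :
    G Γ →* Equiv.Perm {t : Trace (dep Γ) // FreelyReduced t} :=
  PresentedGroup.toGroup (f := fun v => actPerm (v, true)) (by
    rintro r ⟨v, w, h, rfl⟩
    simp only [map_mul, map_inv, FreeGroup.lift_apply_of]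
    rw [mul_inv_eq_one, mul_inv_eq_iff_eq_mul]
    by_cases hvw : v = w
    · rw [hvw]
    · exact Equiv.ext fun t => Subtype.ext
        (act_comm (x := (v, true)) (y := (w, true)) (not_or.2 ⟨hvw, h⟩) t.1))

theorem actHom_gen (v : V) : actHom Γ (gen Γ v) = actPerm (v, true) :=
  PresentedGroup.toGroup.of _

theorem actHom_letter (x : V × Bool) (t : {t : Trace (dep Γ) // FreelyReduced t}) :
    (actHom Γ (eval Γ [x]) t).1 = act x t.1 := by
  obtain ⟨v, _ | _⟩ := x
  · rw [eval_false, map_inv, actHom_gen]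
    rfl
  · rw [eval_true, actHom_gen]
    rfl

theorem freelyReduced_one : FreelyReduced (1 : Trace (dep Γ)) := by
  rintro ⟨p, x, q, h⟩
  have h₁ := congrArg (cnt (dep_refl Γ) x) h
  have h₂ : 0 < cnt (dep_refl Γ) x (letter Γ x) := (cnt_mk_pos _).2 List.mem_cons_self
  rw [cnt_one, cnt_mul, cnt_mul] at h₁
  omega

/-- Van der Waerden's trick: no cancellation occurs when the letters of a freely reduced trace act
successively on `1`, so the group element remembers the trace. -/
theorem actHom_evalTrace {t : Trace (dep Γ)} (ht : FreelyReduced t) :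
    (actHom Γ (evalTrace Γ t) ⟨1, freelyReduced_one⟩).1 = t := by
  obtain ⟨w, rfl⟩ := mk_surjective t
  induction w with
  | nil => rw [mk_nil, map_one, map_one]; rfl
  | cons x w ih =>
    rw [mk_cons] at ht ⊢
    have e := ih ht.of_mul
    rw [map_mul, map_mul, Equiv.Perm.mul_apply, evalTrace_mk, actHom_letter, e, act_of_not]
    · rfl
    · rintro ⟨s, hs⟩
      exact ht ⟨1, x, s, by rw [one_mul, hs]; rfl⟩

/-- Freely reduced traces are normal forms of group elements. -/
theorem FreelyReduced.eq_of_evalTrace_eq {s t : Trace (dep Γ)} (hs : FreelyReduced s)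
    (ht : FreelyReduced t) (h : evalTrace Γ s = evalTrace Γ t) : s = t := by
  rw [← actHom_evalTrace hs, h, actHom_evalTrace ht]

/-! ### Primitive elements with a common root -/

theorem IsPrimitive.eq_one_of_eq_pow {g u : G Γ} (hg : IsPrimitive g) {i : ℕ} (h : g = u ^ i) :
    i = 1 := by
  by_contra hi
  rcases Nat.lt_or_ge i 2 with h' | h'
  · obtain rfl : i = 0 := by omega
    exact hg.1 (by rw [h, pow_zero])
  · exact hg.2 u i h' h

theorem isConj_of_common_root {g₁ g₂ s g₂' w : G Γ} (h₁ : IsPrimitive g₁) (h₂ : IsPrimitive g₂)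
    {i j : ℕ} (hc : g₂ * s = s * g₂') (e₁ : g₁ = w ^ i) (e₂ : g₂' = w ^ j) : IsConj g₁ g₂ := by
  have e : g₂ = s * g₂' * s⁻¹ := by rw [← hc, mul_inv_cancel_right]
  have hi := h₁.eq_one_of_eq_pow e₁
  have hj := h₂.eq_one_of_eq_pow (u := s * w * s⁻¹) (i := j) (by rw [conj_pow, ← e₂, e])
  rw [hi, pow_one] at e₁
  rw [hj, pow_one] at e₂
  exact isConj_iff.2 ⟨s, by rw [e, e₁, e₂]⟩

/-! ### Geodesic traces -/

theorem wordLength_le (w : List (V × Bool)) : wordLength (eval Γ w) ≤ w.length :=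
  Nat.sInf_le ⟨w, rfl, rfl⟩

theorem exists_word (g : G Γ) : ∃ w, eval Γ w = g ∧ w.length = wordLength g := by
  obtain ⟨w, hw⟩ := eval_surjective Γ g
  exact Nat.sInf_mem (s := {k : ℕ | ∃ w : List (V × Bool), eval Γ w = g ∧ w.length = k})
    ⟨_, w, hw, rfl⟩

theorem IsReduced.length_eq {w : List (V × Bool)} (h : IsReduced Γ w) :
    w.length = wordLength (eval Γ w) := by
  obtain ⟨w', hw', hl⟩ := exists_word (eval Γ w)
  exact le_antisymm (hl ▸ h w' hw') (wordLength_le w)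

theorem isReduced_of_length_eq {w : List (V × Bool)} (h : w.length = wordLength (eval Γ w)) :
    IsReduced Γ w := fun w' hw' => by
  rw [h, ← hw']
  exact wordLength_le w'

variable [Fintype V]

theorem exists_trace (g : G Γ) :
    ∃ t, evalTrace Γ t = g ∧ len (dep_refl Γ) t = wordLength g := by
  obtain ⟨w, hw, hl⟩ := exists_word g
  exact ⟨Trace.mk _ w, hw, by rw [len_mk, hl]⟩

theorem wordLength_evalTrace_le (t : Trace (dep Γ)) :
    wordLength (evalTrace Γ t) ≤ len (dep_refl Γ) t := by
  obtain ⟨w, rfl⟩ := mk_surjective t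
  rw [len_mk]
  exact wordLength_le w

theorem freelyReduced_of_len_eq {t : Trace (dep Γ)}
    (h : len (dep_refl Γ) t = wordLength (evalTrace Γ t)) : FreelyReduced t := by
  rintro ⟨p, x, q, rfl⟩
  have e : evalTrace Γ (p * (letter Γ x * (letter Γ (letterInv x) * q))) =
      evalTrace Γ (p * q) := by
    simp only [map_mul, letter, evalTrace_mk]
    rw [← mul_assoc (eval Γ [x]), eval_mul_letterInv, one_mul]
  have := wordLength_evalTrace_le (p * q)
  rw [← e, ← h] at this
  simp only [len_mul, letter, len_mk, List.length_singleton] at this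
  omega

/-- Shortest traces are freely reduced, hence normal forms. This turns geodesic decompositions in
the group into equations of traces. -/
theorem eq_of_len_eq_wordLength {s t : Trace (dep Γ)} {g : G Γ} (hs : evalTrace Γ s = g)
    (ht : evalTrace Γ t = g) (hs' : len (dep_refl Γ) s = wordLength g)
    (ht' : len (dep_refl Γ) t = wordLength g) : s = t :=
  (freelyReduced_of_len_eq (hs'.trans (by rw [hs]))).eq_of_evalTrace_eq
    (freelyReduced_of_len_eq (ht'.trans (by rw [ht]))) (hs.trans ht.symm)

theorem mem_supp_iff {g : G Γ} {t : Trace (dep Γ)} (ht : evalTrace Γ t = g)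
    (hl : len (dep_refl Γ) t = wordLength g) (v : V) :
    v ∈ supp g ↔ ∃ ε, 0 < cnt (dep_refl Γ) (v, ε) t := by
  constructor
  · rintro ⟨w, hw, rfl, ε, hε⟩
    have : t = Trace.mk _ w := eq_of_len_eq_wordLength ht rfl hl (by rw [len_mk, hw.length_eq])
    exact ⟨ε, by rw [this]; exact (cnt_mk_pos _).2 hε⟩
  · rintro ⟨ε, hε⟩
    obtain ⟨w, rfl⟩ := mk_surjective t
    rw [len_mk, ← ht] at hl
    exact ⟨w, isReduced_of_length_eq hl, ht, ε, (cnt_mk_pos _).1 hε⟩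

theorem supp_gen_subset (v : V) : supp (gen Γ v) ⊆ {v} := by
  rintro u ⟨w, hw, he, ε, hε⟩
  have h₁ : w.length ≤ 1 := hw [(v, true)] he.symm
  have h₂ : 0 < w.length := List.length_pos_of_mem hε
  have e : Trace.mk (dep Γ) w = Trace.mk (dep Γ) [(v, true)] :=
    eq_of_len_eq_wordLength (g := gen Γ v) he rfl (by rw [len_mk, hw.length_eq, he])
      (by rw [len_mk, ← he, ← hw.length_eq, List.length_singleton]; omega)
  exact (Prod.mk.inj (List.mem_singleton.1 (mem_of_mk_eq (dep_refl Γ) e hε))).1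

theorem linked_of_walk {g : G Γ} {t : Trace (dep Γ)} (ht : evalTrace Γ t = g)
    (hl : len (dep_refl Γ) t = wordLength g) {u v : supp g} (p : (Γ.induce (supp g)).Walk u v)
    {x y : V × Bool} (hx : x.1 = u ∨ Γ.Adj x.1 u) (hy : (v : V) = y.1 ∨ Γ.Adj v y.1) :
    Linked (dep_refl Γ) t (p.length + 1) x y := by
  induction p generalizing x with
  | @nil u =>
    obtain ⟨ε, hε⟩ := (mem_supp_iff ht hl _).1 u.2
    exact ⟨(u, ε), hε, hx, hy⟩
  | @cons u w v h p ih =>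
    obtain ⟨ε, hε⟩ := (mem_supp_iff ht hl _).1 u.2
    exact ⟨(u, ε), hε, hx, ih (x := (u, ε)) (Or.inr h) hy⟩

theorem IsStronglyNonSplit.spans {g : G Γ} (hg : IsStronglyNonSplit g) {t : Trace (dep Γ)}
    (ht : evalTrace Γ t = g) (hl : len (dep_refl Γ) t = wordLength g) :
    Spans (dep_refl Γ) (Fintype.card V) t := by
  classical
  -- Otherwise the generator `v` would disjointly commute with `g`.
  have hdom : ∀ v : V, ∃ u : supp g, v = u ∨ Γ.Adj v u := by
    intro v
    by_contra! h
    refine hg.2 ⟨v, Set.disjoint_left.2 fun u hu hu' => ?_, fun u hu u' hu' => ?_⟩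
    · exact (h ⟨u, hu'⟩).1 (supp_gen_subset v hu).symm
    · rw [supp_gen_subset v hu]
      exact (h ⟨u', hu'⟩).2
  intro x y
  obtain ⟨u, hu⟩ := hdom x.1
  obtain ⟨v, hv⟩ := hdom y.1
  obtain ⟨p, hp⟩ := (hg.1.preconnected u v).exists_isPath
  refine ⟨p.length + 1, ?_, linked_of_walk ht hl p hu (hv.imp Eq.symm SimpleGraph.Adj.symm)⟩
  -- The interior letters come from the vertices of a path, which are distinct.
  exact hp.length_lt.trans_le (Fintype.card_subtype_le _)

end RAAG

/-! ### The main theorem -/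

open RAAG Trace in
theorem mainTheorem2 {V : Type*} [Finite V] (Γ : SimpleGraph V) (hΓ : Γ.Connected)
    (lam : ℝ) (hlam₀ : 0 ≤ lam) (hlam₁ : lam < 1 / 2) :
    ∃ N : ℕ, 3 ≤ N ∧ ∀ h g₁ g₂ : RAAG.G Γ,
      RAAG.IsQuasiRoot lam N h g₁ → RAAG.IsStronglyNonSplit g₁ → RAAG.IsPrimitive g₁ →
      RAAG.IsQuasiRoot lam N h g₂ → RAAG.IsStronglyNonSplit g₂ → RAAG.IsPrimitive g₂ →
      IsConj g₁ g₂ := by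
  have := Fintype.ofFinite V
  set k := Fintype.card V
  -- From `n * |g| ≤ |h|` and `n ≥ N₀` follows `(3 * k + 5) * |g| < (1 - 2 * lam) * |h|`, the room
  -- required with `M = lam * |h|`.
  obtain ⟨N₀, hN₀⟩ := exists_nat_gt ((3 * k + 5) / (1 - 2 * lam))
  have hpos : 0 < 1 - 2 * lam := by linarith
  refine ⟨max 3 N₀, le_max_left _ _, ?_⟩
  rintro h g₁ g₂ ⟨n, a₁, b₁, hn, e₁, l₁, ha₁, hb₁⟩ hs₁ hp₁ ⟨m, a₂, b₂, hm, e₂, l₂, ha₂, hb₂⟩ hs₂ hp₂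
  have hN : ∀ n, max 3 N₀ ≤ n → (3 * k + 5 : ℝ) < n * (1 - 2 * lam) := fun n hn => by
    rw [div_lt_iff₀ hpos] at hN₀
    have : (N₀ : ℝ) ≤ n := by exact_mod_cast (le_max_right _ _).trans hn
    exact hN₀.trans_le (mul_le_mul_of_nonneg_right this hpos.le)
  obtain ⟨s₁, hs₁e, hs₁l⟩ := exists_trace a₁
  obtain ⟨t₁, ht₁e, ht₁l⟩ := exists_trace g₁
  obtain ⟨r₁, hr₁e, hr₁l⟩ := exists_trace b₁
  obtain ⟨s₂, hs₂e, hs₂l⟩ := exists_trace a₂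
  obtain ⟨t₂, ht₂e, ht₂l⟩ := exists_trace g₂
  obtain ⟨r₂, hr₂e, hr₂l⟩ := exists_trace b₂
  have hl₁ : len (dep_refl Γ) (s₁ * t₁ ^ n * r₁) = wordLength h := by
    rw [len_mul, len_mul, len_pow, hs₁l, ht₁l, hr₁l, l₁]
  have hl₂ : len (dep_refl Γ) (s₂ * t₂ ^ m * r₂) = wordLength h := by
    rw [len_mul, len_mul, len_pow, hs₂l, ht₂l, hr₂l, l₂]
  have e : s₁ * t₁ ^ n * r₁ = s₂ * t₂ ^ m * r₂ :=
    eq_of_len_eq_wordLength (g := h) (by rw [map_mul, map_mul, map_pow, hs₁e, ht₁e, hr₁e, e₁])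
      (by rw [map_mul, map_mul, map_pow, hs₂e, ht₂e, hr₂e, e₂]) hl₁ hl₂
  have hshort : ∀ {g : G Γ} {t : Trace (dep Γ)} {n a b : ℕ}, IsPrimitive g → evalTrace Γ t = g →
      len (dep_refl Γ) t = wordLength g → max 3 N₀ ≤ n →
      wordLength h = a + n * wordLength g + b →
      (3 * k + 5) * (len (dep_refl Γ) t : ℝ) < wordLength h - 2 * (lam * wordLength h) := by
    intro g t n a b hp ht hl hn hh
    have hpos' : (0 : ℝ) < len (dep_refl Γ) t := by
      exact_mod_cast len_pos _ (fun h1 => hp.1 (by rw [← ht, h1, map_one]))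
    have hle : (n : ℝ) * len (dep_refl Γ) t ≤ wordLength h := by
      rw [hl]
      exact_mod_cast (by omega : n * wordLength g ≤ wordLength h)
    calc (3 * k + 5) * (len (dep_refl Γ) t : ℝ)
        < n * (1 - 2 * lam) * len (dep_refl Γ) t := mul_lt_mul_of_pos_right (hN n hn) hpos'
      _ = (1 - 2 * lam) * (n * len (dep_refl Γ) t) := by ring
      _ ≤ (1 - 2 * lam) * wordLength h := mul_le_mul_of_nonneg_left hle hpos.le
      _ = _ := by ring
  have hkn : k ≤ n := by
    have h₁ := hN n hn
    have h₂ : (0 : ℝ) ≤ n * lam := by positivity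
    have h₃ : (k : ℝ) ≤ n := by
      have : (0 : ℝ) ≤ k := Nat.cast_nonneg _
      linarith
    exact_mod_cast h₃
  rcases exists_common_root_of_eq (dep_refl Γ) (dep_symm Γ) (hs₁.spans ht₁e ht₁l)
    (hs₂.spans ht₂e ht₂l) e (M := lam * wordLength h) (by rwa [hs₁l]) (by rwa [hr₁l])
    (by rwa [hs₂l]) (by rwa [hr₂l]) (by rw [hl₁]; exact hshort hp₁ ht₁e ht₁l hn l₁)
    (by rw [hl₁]; exact hshort hp₂ ht₂e ht₂l hm l₂) hkn with
    ⟨s, g', w, i, j, hc, hw, hw'⟩ | ⟨s, g', w, i, j, hc, hw, hw'⟩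
  · exact isConj_of_common_root (s := evalTrace Γ s) (g₂' := evalTrace Γ g') (w := evalTrace Γ w)
      hp₁ hp₂ (by rw [← ht₂e, ← map_mul, hc, map_mul]) (by rw [← ht₁e, hw, map_pow])
      (by rw [hw', map_pow])
  · exact (isConj_of_common_root (s := evalTrace Γ s) (g₂' := evalTrace Γ g')
      (w := evalTrace Γ w) hp₂ hp₁ (by rw [← ht₁e, ← map_mul, hc, map_mul])
      (by rw [← ht₂e, hw, map_pow]) (by rw [hw', map_pow])).symm
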